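/- Let $\mathbb F\in\{\mathbb Q,\mathbb R,\mathbb C\}$. A p-family $(f)=(f_n)_{n\in\mathbb N}$ is a sequence of multivariate polynomials over $\mathbb F$ whose numbers of variables and degrees are polynomially bounded in $n$. For polynomials over a field, $f\le g$ means that $f$ arises from $g$ by substituting for each variable of $g$ a variable of $f$ or a field constant. $L^g(f)$ is the minimum number of nodes of an algebraic circuit (with leaves labelled by variables and field constants, and with $+$, $\times$ and $g$-oracle gates) that computes $f$. For $f,g$ over $\mathbb F$, $f\trianglelefteq g$ means that $f+\varepsilon h\le g$ over $\mathbb F(\varepsilon)$ for some polynomial $h$ over $\mathbb F[\varepsilon]$, and $\overline{L^g}(f)$ is the minimum over all polynomials $h$ over $\mathbb F[\varepsilon]$ of $L^g(f+\varepsilon h)$, taken over $\mathbb F(\varepsilon)$. For families, $(f)\le_{\mathsf p}(g)$, $(f)\trianglelefteq_{\mathsf p}(g)$, $(f)\le_{\mathsf c}(g)$, $(f)\trianglelefteq_{\mathsf c}(g)$ mean that there is a polynomially bounded $t:\mathbb N\to\mathbb N$ such that, respectively, $f_n\le g_{t(n)}$ for all $n$; $f_n\trianglelefteq g_{t(n)}$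 for all $n$; $L^{g_{t(n)}}(f_n)$ is polynomially bounded in $n$; $\overline{L^{g_{t(n)}}}(f_n)$ is polynomially bounded in $n$. Let $\mathrm{HC}_n=\sum_{\pi}\prod_{i=1}^n x_{i,\pi(i)}$, where $\pi$ runs over the cycles of length $n$ in the symmetric group on $n$ symbols. Let $\mathrm{VNP}$ be the set of p-families $(f)$ with $(f)\le_{\mathsf p}(\mathrm{HC})$, and for each of the four reductions $\preceq$ let $\mathrm{VNPC}(\preceq)=\{(f)\in\mathrm{VNP} : (\mathrm{HC})\preceq(f)\}$. Then the following inclusions hold: $\mathrm{VNPC}(\le_{\mathsf p})\subseteq\mathrm{VNPC}(\le_{\mathsf c})$, $\mathrm{VNPC}(\le_{\mathsf p})\subseteq\mathrm{VNPC}(\trianglelefteq_{\mathsf p})$, $\mathrm{VNPC}(\le_{\mathsf c})\subseteq\mathrm{VNPC}(\trianglelefteq_{\mathsf c})$, $\mathrm{VNPC}(\trianglelefteq_{\mathsf p})\subseteq\mathrm{VNPC}(\trianglelefteq_{\mathsf c})$. The following inclusions fail: $\mathrm{VNPC}(\le_{\mathsf c})\not\subseteq\mathrm{VNPC}(\le_{\mathsf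 p})$, $\mathrm{VNPC}(\trianglelefteq_{\mathsf p})\not\subseteq\mathrm{VNPC}(\le_{\mathsf p})$, $\mathrm{VNPC}(\le_{\mathsf c})\not\subseteq\mathrm{VNPC}(\trianglelefteq_{\mathsf p})$, $\mathrm{VNPC}(\trianglelefteq_{\mathsf c})\not\subseteq\mathrm{VNPC}(\trianglelefteq_{\mathsf p})$. More precisely, $(\mathrm{HC}_n^2)_n\in\mathrm{VNPC}(\le_{\mathsf c})\setminus\mathrm{VNPC}(\trianglelefteq_{\mathsf p})$, and the family $P_n=z^2(y\,\mathrm{HC}_n+y^2\,\mathrm{HC}_n^2)$, with $y,z$ two variables that do not occur in $\mathrm{HC}_n$, satisfies $(P)\in\mathrm{VNPC}(\trianglelefteq_{\mathsf p})\setminus\mathrm{VNPC}(\le_{\mathsf p})$. -/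

import Mathlib

namespace AlgRed

open MvPolynomial

/-! ### Families of polynomials -/

/-- A sequence `(f) = (f_n)` of multivariate polynomials over `F`, where `f_n` is a polynomial in
`nvars n` variables. -/
structure PolyFamily (F : Type*) [Field F] where
  /-- the number of variables of `f_n` -/
  nvars : ℕ → ℕ
  /-- the polynomial `f_n` -/
  poly : (n : ℕ) → MvPolynomial (Fin (nvars n)) F

/-- A sequence of natural numbers is polynomially bounded. -/
def PolyBounded (t : ℕ → ℕ) : Prop :=
  ∃ p : Polynomial ℕ, ∀ n, t n ≤ p.eval n

/-- p-families: the number of variables and the degree are polynomially bounded. -/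
def IsPFamily {F : Type*} [Field F] (f : PolyFamily F) : Prop :=
  PolyBounded f.nvars ∧ PolyBounded fun n => (f.poly n).totalDegree

/-! ### Projections -/

/-- `f` is a projection of `g`: it arises from `g` by substituting for every variable
a variable or a field constant. -/
def IsProjection {K : Type*} [Field K] {N M : ℕ}
    (f : MvPolynomial (Fin N) K) (g : MvPolynomial (Fin M) K) : Prop :=
  ∃ α : Fin M → Fin N ⊕ K, f = aeval (fun i => Sum.elim X C (α i)) g

/-- `(f) ≤_p (g)`. -/
def PProj {F : Type*} [Field F] (f g : PolyFamily F) : Prop :=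
  ∃ t : ℕ → ℕ, PolyBounded t ∧ ∀ n, IsProjection (f.poly n) (g.poly (t n))

/-! ### Oracle circuits -/

/-- The nodes that can be added to a circuit which already has `s` nodes: leaves (variables or
constants), addition and multiplication gates, and oracle gates of arity `M`; the inputs of a gate
are nodes that are already there. -/
inductive Gate (K : Type*) (N M s : ℕ) where
  | var (j : Fin N)
  | const (c : K)
  | add (a b : Fin s)
  | mul (a b : Fin s)
  | oracle (a : Fin M → Fin s)

/-- Circuits with `s` nodes (leaves included) in the variables `x_1, …, x_N` with oracle gates of
arity `M`: directed acyclic graphs whose nodes are listed in a topological order. -/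
inductive Circuit (K : Type*) (N M : ℕ) : ℕ → Type _ where
  | empty : Circuit K N M 0
  | snoc {s : ℕ} (c : Circuit K N M s) (γ : Gate K N M s) : Circuit K N M (s + 1)

/-- The polynomial computed at a node, given the polynomials computed at the earlier nodes. -/
noncomputable def Gate.value {K : Type*} [Field K] {N M s : ℕ} (g : MvPolynomial (Fin M) K)
    (v : Fin s → MvPolynomial (Fin N) K) : Gate K N M s → MvPolynomial (Fin N) K
  | .var j => X j
  | .const c => C c
  | .add a b => v a + v b
  | .mul a b => v a * v b
  | .oracle a => aeval (fun i => v (a i)) g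

/-- The polynomials computed at the nodes of a circuit with oracle `g`. -/
noncomputable def Circuit.values {K : Type*} [Field K] {N M : ℕ} (g : MvPolynomial (Fin M) K) :
    {s : ℕ} → Circuit K N M s → Fin s → MvPolynomial (Fin N) K
  | _, .empty => Fin.elim0
  | _, .snoc c γ =>
      Fin.snoc (α := fun _ => MvPolynomial (Fin N) K) (c.values g) (γ.value g (c.values g))

/-- Some circuit with `s` nodes and `g`-oracle gates computes `f` at one of its nodes, the root. -/
def ComputableWithSize {K : Type*} [Field K] {N M : ℕ}
    (g : MvPolynomial (Fin M) K) (f : MvPolynomial (Fin N) K) (s : ℕ) : Prop :=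
  ∃ (c : Circuit K N M s) (root : Fin s), c.values g root = f

/-- The oracle complexity `L^g(f)`: the minimum size of a circuit with `g`-oracle gates that
computes `f`. -/
noncomputable def oracleComplexity {K : Type*} [Field K] {N M : ℕ}
    (g : MvPolynomial (Fin M) K) (f : MvPolynomial (Fin N) K) : ℕ :=
  sInf {s | ComputableWithSize g f s}

/-- Every circuit can be extended so that it also computes a given polynomial. -/
theorem Circuit.exists_extension {K : Type*} [Field K] {N M : ℕ} (g : MvPolynomial (Fin M) K)
    (f : MvPolynomial (Fin N) K) : ∀ {s : ℕ} (c : Circuit K N M s),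
      ∃ (s' : ℕ) (c' : Circuit K N M s') (e : Fin s → Fin s') (j : Fin s'),
        (∀ i, c'.values g (e i) = c.values g i) ∧ c'.values g j = f := by
  induction f using MvPolynomial.induction_on with
  | C a =>
    intro s c
    exact ⟨_, c.snoc (.const a), Fin.castSucc, Fin.last _,
      fun i => by simp [Circuit.values], by simp [Circuit.values, Gate.value]⟩
  | add p q hp hq =>
    intro s c
    obtain ⟨s₁, c₁, e₁, j₁, h₁, k₁⟩ := hp c
    obtain ⟨s₂, c₂, e₂, j₂, h₂, k₂⟩ := hq c₁
    exact ⟨_, c₂.snoc (.add (e₂ j₁) j₂), fun i => (e₂ (e₁ i)).castSucc, Fin.last _,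
      fun i => by simp [Circuit.values, h₁, h₂], by simp [Circuit.values, Gate.value, h₂, k₁, k₂]⟩
  | mul_X p n hp =>
    intro s c
    obtain ⟨s₁, c₁, e₁, j₁, h₁, k₁⟩ := hp c
    exact ⟨_, (c₁.snoc (.var n)).snoc (.mul j₁.castSucc (Fin.last _)),
      fun i => (e₁ i).castSucc.castSucc, Fin.last _,
      fun i => by simp [Circuit.values, h₁], by simp [Circuit.values, Gate.value, k₁]⟩

/-- The minimum in the definition of the oracle complexity is taken over a nonempty set. -/
theorem exists_computableWithSize {K : Type*} [Field K] {N M : ℕ}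
    (g : MvPolynomial (Fin M) K) (f : MvPolynomial (Fin N) K) :
    ∃ s, ComputableWithSize g f s := by
  obtain ⟨s, c, -, j, -, h⟩ := Circuit.exists_extension g f (Circuit.empty (K := K))
  exact ⟨s, c, j, h⟩

/-- `(f) ≤_c (g)`. -/
def CRed {F : Type*} [Field F] (f g : PolyFamily F) : Prop :=
  ∃ t : ℕ → ℕ, PolyBounded t ∧
    PolyBounded fun n => oracleComplexity (g.poly (t n)) (f.poly n)

/-! ### Border reductions -/

/-- A polynomial over `F`, viewed over `F(ε)`. -/
noncomputable def extend {F : Type*} [Field F] {N : ℕ} (f : MvPolynomial (Fin N) F) :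
    MvPolynomial (Fin N) (RatFunc F) :=
  map RatFunc.C f

/-- `f + ε h` as a polynomial over `F(ε)`, for `f` over `F` and `h` over `F[ε]`. -/
noncomputable def perturb {F : Type*} [Field F] {N : ℕ} (f : MvPolynomial (Fin N) F)
    (h : MvPolynomial (Fin N) (Polynomial F)) : MvPolynomial (Fin N) (RatFunc F) :=
  extend f + C RatFunc.X * map (algebraMap (Polynomial F) (RatFunc F)) h

/-- `f ⊴ g`: border projections. -/
def IsBorderProjection {F : Type*} [Field F] {N M : ℕ}
    (f : MvPolynomial (Fin N) F) (g : MvPolynomial (Fin M) F) : Prop :=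
  ∃ h : MvPolynomial (Fin N) (Polynomial F), IsProjection (perturb f h) (extend g)

/-- `(f) ⊴_p (g)`. -/
def BorderPProj {F : Type*} [Field F] (f g : PolyFamily F) : Prop :=
  ∃ t : ℕ → ℕ, PolyBounded t ∧ ∀ n, IsBorderProjection (f.poly n) (g.poly (t n))

/-- The border oracle complexity of `f` with oracle `g`: the smallest `c` such that
`L^g(f + ε h) ≤ c` over `F(ε)` for some `h` over `F[ε]`. -/
noncomputable def borderOracleComplexity {F : Type*} [Field F] {N M : ℕ}
    (g : MvPolynomial (Fin M) F) (f : MvPolynomial (Fin N) F) : ℕ :=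
  sInf {c | ∃ h : MvPolynomial (Fin N) (Polynomial F),
    oracleComplexity (extend g) (perturb f h) ≤ c}

/-- `(f) ⊴_c (g)`. -/
def BorderCRed {F : Type*} [Field F] (f g : PolyFamily F) : Prop :=
  ∃ t : ℕ → ℕ, PolyBounded t ∧
    PolyBounded fun n => borderOracleComplexity (g.poly (t n)) (f.poly n)

/-! ### The Hamiltonian cycle family, VNP and VNP-completeness -/

/-- The cycles of length `n` in the symmetric group on `n` symbols: the permutations
with a single orbit (for `n = 1`, the identity). -/
def fullCycles (n : ℕ) : Finset (Equiv.Perm (Fin n)) :=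
  Finset.univ.filter fun π => ∀ i j, π.SameCycle i j

/-- `HC_n = ∑_{π ∈ C_n} ∏_i x_{i,π(i)}`, where the `n²` variables `x_{i,j}` are numbered by
`finProdFinEquiv`. -/
noncomputable def hcPoly (F : Type*) [Field F] (n : ℕ) : MvPolynomial (Fin (n * n)) F :=
  ∑ π ∈ fullCycles n, ∏ i, X (finProdFinEquiv (i, π i))

/-- The Hamiltonian cycle family `(HC)`. -/
noncomputable def HC (F : Type*) [Field F] : PolyFamily F where
  nvars n := n * n
  poly n := hcPoly F n

/-- The family `(HC²)` of the squares `HC_n²`. -/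
noncomputable def HCsq (F : Type*) [Field F] : PolyFamily F where
  nvars n := n * n
  poly n := hcPoly F n ^ 2

/-- The family `(P)` with `P_n = z² (y HC_n + y² HC_n²)`, where `y` and `z` are two variables
outside the variables of `HC_n`. -/
noncomputable def PFam (F : Type*) [Field F] : PolyFamily F where
  nvars n := n * n + 2
  poly n :=
    let y : MvPolynomial (Fin (n * n + 2)) F := X (Fin.natAdd (n * n) 0)
    let z : MvPolynomial (Fin (n * n + 2)) F := X (Fin.natAdd (n * n) 1)
    let hc : MvPolynomial (Fin (n * n + 2)) F := rename (Fin.castAdd 2) (hcPoly F n)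
    z ^ 2 * (y * hc + y ^ 2 * hc ^ 2)

/-- `VNP`: the p-families that are p-projections of `(HC)`. -/
def VNP (F : Type*) [Field F] : Set (PolyFamily F) :=
  {f | IsPFamily f ∧ PProj f (HC F)}

/-- `VNPC(≼)`: the families in `VNP` to which `(HC)` reduces under the reduction notion `≼`. -/
def VNPC {F : Type*} [Field F] (red : PolyFamily F → PolyFamily F → Prop) :
    Set (PolyFamily F) :=
  {f | f ∈ VNP F ∧ red (HC F) f}

end AlgRed

open AlgRed

/-! The inclusions are formal. The choice `h = 0` makes a reduction a border reduction, and a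
projection is a circuit with one oracle gate whose inputs are leaves; there are polynomially many of
them because the oracle is a p-family.

Both separating families lie in VNP because projections of Hamiltonian cycle polynomials are closed
under products and sums at polynomial cost. Splicing two cycle covers gives products
(`hamSum_joinMatrix`). Replacing each vertex by a two-way path that every Hamiltonian cycle must
traverse in one common direction gives sums (`hamSum_sumMatrix`).

Write `H` for `HC_n`. The identity `4H = (1 + H)² - (1 - H)²` computes `H` with two oracle calls to
a square. A border projection from a square would make `H + εh` a square over `F(ε)`. Specialising
`H` to one variable `X`, clearing denominators and putting `ε = 0` would make `X` a square in
`F[X]`, against the parity of degrees (`X_add_ne_sq`).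

For `P`, the substitution `y = ε²`, `z = ε⁻¹` yields `H + ε²H²`, a border projection. An exact
projection would give, after the same specialisation, `X = a²(u + u²)`; the right side, if nonzero,
has even degree (`X_ne_sq_mul`). -/

namespace AlgRed

open MvPolynomial

/-! ### Full cycles, and products and sums of Hamiltonian cycle sums. -/

section HamiltonianSums

variable {ι κ V R : Type*}

/-- A permutation with a single orbit. -/
def IsFullCycle (π : Equiv.Perm ι) : Prop := ∀ i j, π.SameCycle i j

/-- Induction along a cycle: on a finite type, nonnegative powers already reach the whole orbit, so
closure under `π` alone suffices. Most orbit arguments below take this form. -/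
theorem IsFullCycle.mem_of_closed [Finite ι] {π : Equiv.Perm ι} (h : IsFullCycle π) {S : Set ι}
    (hS : ∀ i ∈ S, π i ∈ S) {i : ι} (hi : i ∈ S) (j : ι) : j ∈ S := by
  obtain ⟨k, rfl⟩ := (h i j).exists_nat_pow_eq
  induction k with
  | zero => simpa using hi
  | succ k ih => rw [pow_succ', Equiv.Perm.mul_apply]; exact hS _ ih

theorem isFullCycle_of_forall (π : Equiv.Perm ι) (i : ι) (h : ∀ j, π.SameCycle i j) :
    IsFullCycle π := fun j k => (h j).symm.trans (h k)

theorem IsFullCycle.conj {π : Equiv.Perm ι} (h : IsFullCycle π) (g : Equiv.Perm ι) :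
    IsFullCycle (g * π * g⁻¹) := fun i j => by
  rw [Equiv.Perm.sameCycle_conj]; exact h _ _

theorem isFullCycle_permCongr (e : ι ≃ κ) (π : Equiv.Perm ι) :
    IsFullCycle (e.permCongr π) ↔ IsFullCycle π := by
  have key : ∀ (k : ℤ) (i : ι), (e.permCongr π ^ k) (e i) = e ((π ^ k) i) := by
    intro k i
    have : e.permCongr π ^ k = e.permCongr (π ^ k) := (map_zpow e.permCongrHom π k).symm
    rw [this]; simp
  constructor
  · intro h i j
    obtain ⟨k, hk⟩ := h (e i) (e j)
    exact ⟨k, e.injective (by rw [← key, hk])⟩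
  · intro h i j
    obtain ⟨i, rfl⟩ := e.surjective i
    obtain ⟨j, rfl⟩ := e.surjective j
    obtain ⟨k, hk⟩ := h i j
    exact ⟨k, by rw [key, hk]⟩

theorem isFullCycle_finRotate (n : ℕ) : IsFullCycle (finRotate (n + 1)) := by
  refine isFullCycle_of_forall _ 0 fun j => ?_
  induction j using Fin.induction with
  | zero => exact Equiv.Perm.SameCycle.refl _ _
  | succ j ih =>
    have : j.succ = finRotate (n + 1) j.castSucc := by simp
    rw [this]
    exact Equiv.Perm.sameCycle_apply_right.2 ih

/-! #### Joining and subdividing cycles -/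

section

variable [DecidableEq ι] [DecidableEq κ]

/-- The join of two permutations at `a` and `b`: the arrows into `a` and `b` are exchanged. -/
def joinPerm (a : ι) (b : κ) (π : Equiv.Perm ι × Equiv.Perm κ) : Equiv.Perm (ι ⊕ κ) :=
  Equiv.swap (Sum.inl a) (Sum.inr b) * Equiv.Perm.sumCongr π.1 π.2

theorem joinPerm_inl (a : ι) (b : κ) (π : Equiv.Perm ι × Equiv.Perm κ) (i : ι) :
    joinPerm a b π (Sum.inl i) = if π.1 i = a then Sum.inr b else Sum.inl (π.1 i) := by
  simp [joinPerm, Equiv.swap_apply_def]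

theorem joinPerm_inr (a : ι) (b : κ) (π : Equiv.Perm ι × Equiv.Perm κ) (i : κ) :
    joinPerm a b π (Sum.inr i) = if π.2 i = b then Sum.inl a else Sum.inr (π.2 i) := by
  simp [joinPerm, Equiv.swap_apply_def]

/-- Exchanging the arrows into `a` and `b` splices one cycle from each side into a single cycle;
conversely, contracting one side to its marked point recovers the permutation on the other side. -/
theorem isFullCycle_joinPerm [Finite ι] [Finite κ] (a : ι) (b : κ) (π : Equiv.Perm ι × Equiv.Perm κ) :
    IsFullCycle (joinPerm a b π) ↔ IsFullCycle π.1 ∧ IsFullCycle π.2 := by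
  constructor
  · intro h
    constructor
    · refine isFullCycle_of_forall _ a fun j => ?_
      -- All of `κ` is contracted to `a`: the join leaves `ι` only where `π.1` would enter `a`, and
      -- it returns at `a`.
      refine h.mem_of_closed (S := {x | π.1.SameCycle a (Sum.elim id (fun _ => a) x)})
        (i := Sum.inl a) ?_ (Equiv.Perm.SameCycle.refl _ _) (Sum.inl j)
      rintro (i | i) hi
      · have hi' : π.1.SameCycle a (π.1 i) := Equiv.Perm.sameCycle_apply_right.2 hi
        rw [joinPerm_inl]
        split_ifs with h1
        · exact Equiv.Perm.SameCycle.refl _ _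
        · exact hi'
      · rw [joinPerm_inr]
        split_ifs with h1 <;> exact Equiv.Perm.SameCycle.refl _ _
    · refine isFullCycle_of_forall _ b fun j => ?_
      refine h.mem_of_closed (S := {x | π.2.SameCycle b (Sum.elim (fun _ => b) id x)})
        (i := Sum.inr b) ?_ (Equiv.Perm.SameCycle.refl _ _) (Sum.inr j)
      rintro (i | i) hi
      · rw [joinPerm_inl]
        split_ifs with h1 <;> exact Equiv.Perm.SameCycle.refl _ _
      · have hi' : π.2.SameCycle b (π.2 i) := Equiv.Perm.sameCycle_apply_right.2 hi
        rw [joinPerm_inr]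
        split_ifs with h1
        · exact Equiv.Perm.SameCycle.refl _ _
        · exact hi'
  · rintro ⟨h₁, h₂⟩
    have hA : ∀ i, (joinPerm a b π).SameCycle (Sum.inl a) (Sum.inl i) := by
      refine h₁.mem_of_closed (S := {i | (joinPerm a b π).SameCycle (Sum.inl a) (Sum.inl i)})
        (fun i hi => ?_) (Equiv.Perm.SameCycle.refl _ _)
      have hi' := Equiv.Perm.sameCycle_apply_right.2 hi
      rw [joinPerm_inl] at hi'
      split_ifs at hi' with h1
      · rw [Set.mem_ofPred_eq, h1]
      · exact hi'
    have hB : ∀ i, (joinPerm a b π).SameCycle (Sum.inr b) (Sum.inr i) := by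
      refine h₂.mem_of_closed (S := {i | (joinPerm a b π).SameCycle (Sum.inr b) (Sum.inr i)})
        (fun i hi => ?_) (Equiv.Perm.SameCycle.refl _ _)
      have hi' := Equiv.Perm.sameCycle_apply_right.2 hi
      rw [joinPerm_inr] at hi'
      split_ifs at hi' with h1
      · rw [Set.mem_ofPred_eq, h1]
      · exact hi'
    -- The arrow of `π.1` into `a` now ends at `b`, which connects the two sides.
    have hAB : (joinPerm a b π).SameCycle (Sum.inl a) (Sum.inr b) := by
      have := Equiv.Perm.sameCycle_apply_right.2 (hA (π.1⁻¹ a))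
      rwa [joinPerm_inl, if_pos (by simp)] at this
    refine isFullCycle_of_forall _ (Sum.inl a) ?_
    rintro (i | i)
    · exact hA i
    · exact hAB.trans (hB i)

end

/-- The permutation `(v, 0) ↦ (v, 1) ↦ (v, 2) ↦ (π v, 0)`. -/
def forwardPerm (π : Equiv.Perm V) : Equiv.Perm (V × Fin 3) where
  toFun
    | (v, 0) => (v, 1)
    | (v, 1) => (v, 2)
    | (v, 2) => (π v, 0)
  invFun
    | (v, 0) => (π⁻¹ v, 2)
    | (v, 1) => (v, 0)
    | (v, 2) => (v, 1)
  left_inv := by rintro ⟨v, i⟩; fin_cases i <;> simp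
  right_inv := by rintro ⟨v, i⟩; fin_cases i <;> simp

theorem forwardPerm_zero (π : Equiv.Perm V) (v : V) : forwardPerm π (v, 0) = (v, 1) := rfl
theorem forwardPerm_one (π : Equiv.Perm V) (v : V) : forwardPerm π (v, 1) = (v, 2) := rfl
theorem forwardPerm_two (π : Equiv.Perm V) (v : V) : forwardPerm π (v, 2) = (π v, 0) := rfl

/-- The reversal `(v, i) ↦ (v, 2 - i)`. -/
def revPerm : Equiv.Perm (V × Fin 3) := Equiv.prodCongr (Equiv.refl V) Fin.revPerm

theorem revPerm_inv : (revPerm : Equiv.Perm (V × Fin 3))⁻¹ = revPerm := rfl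

theorem revPerm_revPerm (x : V × Fin 3) : revPerm (revPerm x) = x := by
  rw [← Equiv.Perm.mul_apply]; nth_rw 1 [← revPerm_inv]; simp

/-- The permutation `(v, 2) ↦ (v, 1) ↦ (v, 0) ↦ (π v, 2)`. -/
def backwardPerm (π : Equiv.Perm V) : Equiv.Perm (V × Fin 3) :=
  revPerm * forwardPerm π * revPerm⁻¹

/-- The permutation runs through a whole fibre of `V × Fin 3 → V` before moving on by `π`, so its
orbits are the preimages of the orbits of `π`. -/
theorem isFullCycle_forwardPerm [Finite V] (π : Equiv.Perm V) :
    IsFullCycle (forwardPerm π) ↔ IsFullCycle π := by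
  constructor
  · intro h v w
    refine h.mem_of_closed (S := {x | π.SameCycle v x.1}) (i := (v, 0)) ?_
      (Equiv.Perm.SameCycle.refl _ _) (w, 0)
    rintro ⟨u, i⟩ (hu : π.SameCycle v u)
    fin_cases i
    · exact hu
    · exact hu
    · exact Equiv.Perm.sameCycle_apply_right.2 hu
  · intro h
    have h01 : ∀ w x, (forwardPerm π).SameCycle x (w, 1) ↔ (forwardPerm π).SameCycle x (w, 0) :=
      fun w x => by rw [← forwardPerm_zero π w]; exact Equiv.Perm.sameCycle_apply_right
    have h12 : ∀ w x, (forwardPerm π).SameCycle x (w, 2) ↔ (forwardPerm π).SameCycle x (w, 1) :=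
      fun w x => by rw [← forwardPerm_one π w]; exact Equiv.Perm.sameCycle_apply_right
    have h20 : ∀ w x, (forwardPerm π).SameCycle x (π w, 0) ↔ (forwardPerm π).SameCycle x (w, 2) :=
      fun w x => by rw [← forwardPerm_two π w]; exact Equiv.Perm.sameCycle_apply_right
    have key : ∀ v w, (forwardPerm π).SameCycle (v, 0) (w, 0) := fun v =>
      h.mem_of_closed (S := {w | (forwardPerm π).SameCycle (v, 0) (w, 0)})
        (fun w hw => (h20 _ _).2 ((h12 _ _).2 ((h01 _ _).2 hw))) (Equiv.Perm.SameCycle.refl _ _)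
    rintro ⟨v, i⟩
    refine fun x => isFullCycle_of_forall _ (v, 0) ?_ _ _
    rintro ⟨w, j⟩
    fin_cases j
    · exact key v w
    · exact (h01 _ _).2 (key v w)
    · exact (h12 _ _).2 ((h01 _ _).2 (key v w))

theorem isFullCycle_backwardPerm [Finite V] (π : Equiv.Perm V) :
    IsFullCycle (backwardPerm π) ↔ IsFullCycle π := by
  rw [← isFullCycle_forwardPerm π]
  refine ⟨fun h => ?_, fun h => h.conj revPerm⟩
  have := IsFullCycle.conj h revPerm⁻¹
  simpa [backwardPerm, mul_assoc] using this

theorem forwardPerm_injective : Function.Injective (forwardPerm (V := V)) := fun π ρ h =>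
  Equiv.ext fun v => by
    have : forwardPerm π (v, 2) = forwardPerm ρ (v, 2) := by rw [h]
    simpa [forwardPerm_two] using this

theorem backwardPerm_injective : Function.Injective (backwardPerm (V := V)) := fun π ρ h =>
  forwardPerm_injective (by simpa [backwardPerm] using h)

theorem forwardPerm_ne_backwardPerm [Nonempty V] (π ρ : Equiv.Perm V) :
    forwardPerm π ≠ backwardPerm ρ := fun h => by
  have v : V := Classical.arbitrary V
  have : forwardPerm π (v, 1) = backwardPerm ρ (v, 1) := by rw [h]
  have h' : backwardPerm ρ (v, 1) = (v, 0) := rfl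
  rw [h', forwardPerm_one] at this
  simp at this

section

variable [Fintype ι] [DecidableEq ι] [Fintype κ] [DecidableEq κ] [CommSemiring R]

/-! #### Sums over Hamiltonian cycles -/

open Classical in
/-- The Hamiltonian cycle polynomial evaluated at a matrix with an arbitrary index type. -/
noncomputable def hamSum (M : ι → ι → R) : R :=
  ∑ π : Equiv.Perm ι with IsFullCycle π, ∏ i, M i (π i)

theorem hamSum_reindex (e : κ ≃ ι) (M : ι → ι → R) :
    hamSum (fun i j => M (e i) (e j)) = hamSum M := by
  classical
  refine Finset.sum_equiv e.permCongr (fun π => ?_) fun π _ => ?_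
  · simp [isFullCycle_permCongr]
  · exact Fintype.prod_equiv e _ _ fun i => by simp

/-- Serves both to write `1` as a Hamiltonian cycle sum of any positive size and to specialise `HC`
to a single variable. -/
theorem hamSum_of_single {c : Equiv.Perm ι} (hc : IsFullCycle c) (M : ι → ι → R)
    (hM : ∀ i j, j ≠ c i → M i j = 0) : hamSum M = ∏ i, M i (c i) := by
  classical
  refine Finset.sum_eq_single_of_mem c (by simpa using hc) fun π _ hπ => ?_
  obtain ⟨i, hi⟩ : ∃ i, π i ≠ c i := by
    by_contra! h
    exact hπ (Equiv.ext h)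
  exact Finset.prod_eq_zero (Finset.mem_univ i) (hM i _ hi)

/-- The matrix whose Hamiltonian cycles are the joins of those of `M` and of `N`. -/
def joinMatrix (a : ι) (b : κ) (M : ι → ι → R) (N : κ → κ → R) (i j : ι ⊕ κ) : R :=
  Matrix.fromBlocks (Matrix.of M) 0 0 (Matrix.of N) i (Equiv.swap (Sum.inl a) (Sum.inr b) j)

/-- The matrix is block diagonal up to exchanging columns `a` and `b`. A permutation supported on it
therefore preserves both blocks once the swap is undone, hence is a join, and joins are full cycles
exactly when both parts are. -/
theorem hamSum_joinMatrix (a : ι) (b : κ) (M : ι → ι → R) (N : κ → κ → R) :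
    hamSum (joinMatrix a b M N) = hamSum M * hamSum N := by
  classical
  rw [hamSum, hamSum, hamSum, Finset.sum_mul_sum, ← Finset.sum_product']
  symm
  refine Finset.sum_of_injOn (joinPerm a b) ?_ ?_ ?_ ?_
  · intro π _ ρ _ h
    have h' := Equiv.Perm.sumCongrHom_injective (α := ι) (β := κ) (a₁ := π) (a₂ := ρ)
      (mul_left_cancel h)
    exact h'
  · intro π hπ
    simpa [isFullCycle_joinPerm] using hπ
  · intro σ hσ hσ'
    by_contra hne
    have hsupp : ∀ i, joinMatrix a b M N i (σ i) ≠ 0 := fun i hi =>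
      hne (Finset.prod_eq_zero (Finset.mem_univ i) hi)
    set τ := Equiv.swap (Sum.inl a) (Sum.inr b) * σ with hτ
    have hmaps : Set.MapsTo τ (Set.range Sum.inl) (Set.range Sum.inl) := by
      rintro _ ⟨i, rfl⟩
      have := hsupp (Sum.inl i)
      rcases hi : τ (Sum.inl i) with j | j
      · exact ⟨j, rfl⟩
      · refine absurd ?_ this
        change Matrix.fromBlocks (Matrix.of M) 0 0 (Matrix.of N) _ (τ (Sum.inl i)) = 0
        rw [hi]; rfl
    obtain ⟨π, hπ⟩ := Equiv.Perm.mem_sumCongrHom_range_of_perm_mapsTo_inl hmaps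
    have hστ : joinPerm a b π = σ := by
      have : Equiv.Perm.sumCongr π.1 π.2 = τ := hπ
      rw [joinPerm, this, hτ, ← mul_assoc, Equiv.swap_mul_self, one_mul]
    refine hσ' ⟨π, ?_, hστ⟩
    rw [← hστ] at hσ
    simpa [isFullCycle_joinPerm] using hσ
  · intro π _
    simp [Fintype.prod_sum_type, joinMatrix, joinPerm]

end

section

variable [DecidableEq V] [CommSemiring R]

/-- The matrix on `V × Fin 3` in which every vertex `v` is replaced by a two-way path
`(v, 0) ↔ (v, 1) ↔ (v, 2)`; the arrows `(v, 2) → (w, 0)` carry the weights of `A`, the arrows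
`(v, 0) → (w, 2)` those of `B`. Its Hamiltonian cycles traverse either all paths forwards
or all paths backwards. -/
def sumMatrix (A B : V → V → R) : V × Fin 3 → V × Fin 3 → R
  | (v, 0), (w, 1) => if w = v then 1 else 0
  | (v, 1), (w, 2) => if w = v then 1 else 0
  | (v, 2), (w, 0) => A v w
  | (v, 2), (w, 1) => if w = v then 1 else 0
  | (v, 1), (w, 0) => if w = v then 1 else 0
  | (v, 0), (w, 2) => B v w
  | (_, 0), (_, 0) => 0
  | (_, 1), (_, 1) => 0
  | (_, 2), (_, 2) => 0

theorem sumMatrix_revPerm (A B : V → V → R) (x y : V × Fin 3) :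
    sumMatrix A B (revPerm x) (revPerm y) = sumMatrix B A x y := by
  obtain ⟨v, i⟩ := x
  obtain ⟨w, j⟩ := y
  fin_cases i <;> fin_cases j <;> rfl

end

variable [Fintype V] [DecidableEq V] [CommSemiring R]

theorem prod_sumMatrix_forwardPerm (A B : V → V → R) (π : Equiv.Perm V) :
    ∏ x, sumMatrix A B x (forwardPerm π x) = ∏ v, A v (π v) := by
  rw [Fintype.prod_prod_type]
  refine Finset.prod_congr rfl fun v _ => ?_
  rw [Fin.prod_univ_three, forwardPerm_zero, forwardPerm_one, forwardPerm_two]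
  simp [sumMatrix]

theorem prod_sumMatrix_backwardPerm (A B : V → V → R) (π : Equiv.Perm V) :
    ∏ x, sumMatrix A B x (backwardPerm π x) = ∏ v, B v (π v) := by
  rw [← prod_sumMatrix_forwardPerm B A, ← Equiv.prod_comp revPerm]
  refine Finset.prod_congr rfl fun x _ => ?_
  rw [← sumMatrix_revPerm A B]
  simp [backwardPerm]

/-- A Hamiltonian cycle of `sumMatrix A B` that traverses one path forwards traverses all paths
forwards. -/
theorem exists_eq_forwardPerm (A B : V → V → R) {σ : Equiv.Perm (V × Fin 3)} (hσ : IsFullCycle σ)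
    (hsupp : ∀ x, sumMatrix A B x (σ x) ≠ 0) {v₀ : V} (hv₀ : σ (v₀, 1) = (v₀, 2)) :
    ∃ π, forwardPerm π = σ := by
  have h0 : ∀ v, σ (v, 0) = (v, 1) ∨ ∃ w, σ (v, 0) = (w, 2) := by
    intro v
    have := hsupp (v, 0)
    rcases h : σ (v, 0) with ⟨w, j⟩
    rw [h] at this
    fin_cases j <;> simp_all [sumMatrix]
  have h1 : ∀ v, σ (v, 1) = (v, 2) ∨ σ (v, 1) = (v, 0) := by
    intro v
    have := hsupp (v, 1)
    rcases h : σ (v, 1) with ⟨w, j⟩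
    rw [h] at this
    fin_cases j <;> simp_all [sumMatrix]
  have h2 : ∀ v, σ (v, 2) = (v, 1) ∨ ∃ w, σ (v, 2) = (w, 0) := by
    intro v
    have := hsupp (v, 2)
    rcases h : σ (v, 2) with ⟨w, j⟩
    rw [h] at this
    fin_cases j <;> simp_all [sumMatrix]
  -- An arrow from `(v, 2)` back to `(v, 1)` would close a 2-cycle that misses `(v, 0)`. Without it,
  -- `(v, 0)` is the only possible predecessor of `(v, 1)`.
  have hF : ∀ v, σ (v, 1) = (v, 2) → σ (v, 0) = (v, 1) ∧ ∃ w, σ (v, 2) = (w, 0) := by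
    intro v hv
    have hne : σ (v, 2) ≠ (v, 1) := by
      intro hv'
      have := hσ.mem_of_closed (S := {(v, 1), (v, 2)}) (i := (v, 1)) (by
        rintro x (rfl | rfl)
        · rw [hv]; simp
        · rw [hv']; simp) (by simp) (v, 0)
      simp at this
    refine ⟨?_, (h2 v).resolve_left hne⟩
    obtain ⟨⟨w, j⟩, hw⟩ := σ.surjective (v, 1)
    fin_cases j
    · rcases h0 w with h | ⟨u, h⟩
      · have : w = v := by simpa using h.symm.trans hw
        rwa [this] at h
      · exact absurd (h.symm.trans hw) (by simp)
    · rcases h1 w with h | h <;> exact absurd (h.symm.trans hw) (by simp)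
    · rcases h2 w with h | ⟨u, h⟩
      · have : w = v := by simpa using h.symm.trans hw
        rw [this] at h
        exact absurd h hne
      · exact absurd (h.symm.trans hw) (by simp)
  -- The direction propagates along the cycle: a forward path is left towards some `(w, 0)`, and
  -- then `(w, 1)` cannot also map to `(w, 0)`.
  have hall : ∀ v, σ (v, 1) = (v, 2) := by
    intro v
    refine hσ.mem_of_closed (S := {x | σ (x.1, 1) = (x.1, 2)}) (i := (v₀, 1)) ?_ hv₀ (v, 1)
    rintro ⟨u, i⟩ (hu : σ (u, 1) = (u, 2))
    fin_cases i
    · change σ ((σ (u, 0)).1, 1) = ((σ (u, 0)).1, 2)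
      rw [(hF u hu).1]; exact hu
    · change σ ((σ (u, 1)).1, 1) = ((σ (u, 1)).1, 2)
      rw [hu]; exact hu
    · change σ ((σ (u, 2)).1, 1) = ((σ (u, 2)).1, 2)
      obtain ⟨w, hw⟩ := (hF u hu).2
      rw [hw]
      refine (h1 w).resolve_right fun hw' => ?_
      have := σ.injective (hw.trans hw'.symm)
      simp at this
  choose f hf using fun v => (hF v (hall v)).2
  have hinj : Function.Injective f := fun v w hvw => by
    have : σ (v, 2) = σ (w, 2) := by rw [hf, hf, hvw]
    simpa using σ.injective this
  refine ⟨Equiv.ofBijective f (Finite.injective_iff_bijective.1 hinj), Equiv.ext ?_⟩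
  rintro ⟨v, i⟩
  fin_cases i
  · exact ((hF v (hall v)).1).symm
  · exact (hall v).symm
  · exact (hf v).symm

/-- Forward cycles contribute the sum for `A`, backward cycles the sum for `B`. `Nonempty V`
matters: on the empty type the empty permutation is a full cycle, so the left side would be `1` and
the right side `1 + 1`. -/
theorem hamSum_sumMatrix [Nonempty V] (A B : V → V → R) :
    hamSum (sumMatrix A B) = hamSum A + hamSum B := by
  classical
  rw [hamSum, hamSum, hamSum]
  simp_rw [← prod_sumMatrix_forwardPerm A B]
  simp_rw [← prod_sumMatrix_backwardPerm A B]
  refine Eq.trans ?_ (Finset.sum_disjSum _ _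
    (fun π => ∏ x, sumMatrix A B x (Sum.elim forwardPerm backwardPerm π x)))
  symm
  refine Finset.sum_of_injOn (Sum.elim forwardPerm backwardPerm) ?_ ?_ ?_ fun _ _ => rfl
  · refine Function.Injective.injOn ?_
    exact forwardPerm_injective.sumElim backwardPerm_injective forwardPerm_ne_backwardPerm
  · rintro (π | π) hπ
    · simpa [isFullCycle_forwardPerm] using hπ
    · simpa [isFullCycle_backwardPerm] using hπ
  · intro σ hσ hσ'
    by_contra hne
    have hsupp : ∀ i, sumMatrix A B i (σ i) ≠ 0 := fun i hi =>
      hne (Finset.prod_eq_zero (Finset.mem_univ i) hi)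
    have hfull : IsFullCycle σ := by simpa using hσ
    by_cases hv : ∃ v, σ (v, 1) = (v, 2)
    · obtain ⟨v, hv⟩ := hv
      obtain ⟨π, rfl⟩ := exists_eq_forwardPerm A B hfull hsupp hv
      exact hσ' ⟨Sum.inl π, by simpa [isFullCycle_forwardPerm] using hfull, rfl⟩
    -- No path is traversed forwards, so the one at `v` is traversed backwards; conjugating by the
    -- reversal exchanges `A` and `B` and reduces to the forward case.
    · have v : V := Classical.arbitrary V
      have hsupp' : ∀ x, sumMatrix B A x ((revPerm * σ * revPerm⁻¹ : Equiv.Perm (V × Fin 3)) x) ≠ 0 := by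
        intro x
        have := hsupp (revPerm x)
        rw [← revPerm_revPerm (σ (revPerm x)), sumMatrix_revPerm] at this
        simpa [revPerm_inv] using this
      have hback : (revPerm * σ * revPerm⁻¹ : Equiv.Perm (V × Fin 3)) (v, 1) = (v, 2) := by
        have h1 := hsupp (v, 1)
        have : σ (v, 1) = (v, 0) := by
          rcases h : σ (v, 1) with ⟨w, j⟩
          rw [h] at h1
          by_cases hw : w = v
          · subst hw
            fin_cases j
            · rfl
            · simp [sumMatrix] at h1
            · exact absurd ⟨w, h⟩ hv
          · fin_cases j <;> simp [sumMatrix, hw] at h1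
        change revPerm (σ (v, 1)) = _
        rw [this]; rfl
      obtain ⟨π, hπ⟩ := exists_eq_forwardPerm B A (hfull.conj _) hsupp' hback
      have hπ' : backwardPerm π = σ := by
        rw [backwardPerm, hπ, revPerm_inv]
        ext x : 1
        simp [revPerm_revPerm]
      subst hπ'
      exact hσ' ⟨Sum.inr π, by simpa [isFullCycle_backwardPerm] using hfull, rfl⟩

end HamiltonianSums

/-! ### Projections of Hamiltonian cycle polynomials -/

section Projections

variable {K : Type*} [Field K] {N M : ℕ}

/-- The polynomials that may be substituted in a projection: variables and constants. -/
def IsLeaf (p : MvPolynomial (Fin N) K) : Prop := ∃ a : Fin N ⊕ K, p = Sum.elim X C a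

theorem isLeaf_X (i : Fin N) : IsLeaf (X i : MvPolynomial (Fin N) K) := ⟨Sum.inl i, rfl⟩

theorem isLeaf_C (c : K) : IsLeaf (C c : MvPolynomial (Fin N) K) := ⟨Sum.inr c, rfl⟩

theorem isLeaf_zero : IsLeaf (0 : MvPolynomial (Fin N) K) := by
  simpa using isLeaf_C (N := N) (0 : K)

theorem isLeaf_one : IsLeaf (1 : MvPolynomial (Fin N) K) := by
  simpa using isLeaf_C (N := N) (1 : K)

theorem isProjection_iff {f : MvPolynomial (Fin N) K} {g : MvPolynomial (Fin M) K} :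
    IsProjection f g ↔ ∃ v : Fin M → MvPolynomial (Fin N) K, (∀ i, IsLeaf (v i)) ∧
      f = aeval v g := by
  constructor
  · rintro ⟨α, h⟩
    exact ⟨_, fun i => ⟨α i, rfl⟩, h⟩
  · rintro ⟨v, hv, h⟩
    choose α hα using hv
    exact ⟨α, by rw [h]; congr 2; exact funext hα⟩

theorem aeval_hcPoly {A : Type*} [CommSemiring A] [Algebra K A] (n : ℕ) (v : Fin (n * n) → A) :
    aeval v (hcPoly K n) = hamSum fun i j => v (finProdFinEquiv (i, j)) := by
  classical
  rw [hcPoly, hamSum, map_sum]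
  refine Finset.sum_congr (by ext π; rw [fullCycles, Finset.mem_filter, Finset.mem_filter]; rfl) fun π _ => ?_
  rw [map_prod]
  simp

/-- `f` is a projection of `HC_m`, and `m` is positive. -/
def IsHCProjection (m : ℕ) (f : MvPolynomial (Fin N) K) : Prop :=
  0 < m ∧ IsProjection f (hcPoly K m)

theorem IsHCProjection.of_matrix {ι : Type*} [Fintype ι] [DecidableEq ι] [Nonempty ι] {m : ℕ}
    (hm : Fintype.card ι = m) (A : ι → ι → MvPolynomial (Fin N) K) (hA : ∀ i j, IsLeaf (A i j)) :
    IsHCProjection m (hamSum A) := by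
  subst hm
  refine ⟨Fintype.card_pos, isProjection_iff.2
    ⟨fun k => A ((Fintype.equivFin ι).symm (finProdFinEquiv.symm k).1)
      ((Fintype.equivFin ι).symm (finProdFinEquiv.symm k).2), fun k => hA _ _, ?_⟩⟩
  rw [aeval_hcPoly, ← hamSum_reindex (Fintype.equivFin ι).symm]
  simp

theorem IsHCProjection.exists_matrix {m : ℕ} {f : MvPolynomial (Fin N) K}
    (h : IsHCProjection m f) :
    ∃ A : Fin m → Fin m → MvPolynomial (Fin N) K, (∀ i j, IsLeaf (A i j)) ∧ f = hamSum A := by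
  obtain ⟨v, hv, h⟩ := isProjection_iff.1 h.2
  exact ⟨_, fun i j => hv _, h.trans (aeval_hcPoly _ _)⟩

theorem IsLeaf.isHCProjection {p : MvPolynomial (Fin N) K} (hp : IsLeaf p) :
    IsHCProjection 1 p := by
  have h := IsHCProjection.of_matrix (ι := Fin 1) (m := 1) (by simp) (fun _ _ => p) fun _ _ => hp
  rwa [hamSum_of_single (c := 1) (fun i j => by rw [Subsingleton.elim i j]) _
    fun i j hij => absurd (Subsingleton.elim _ _) hij, Fin.prod_univ_one] at h

theorem isHCProjection_one {m : ℕ} (hm : 0 < m) :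
    IsHCProjection m (1 : MvPolynomial (Fin N) K) := by
  obtain ⟨m, rfl⟩ := Nat.exists_eq_succ_of_ne_zero hm.ne'
  have h := IsHCProjection.of_matrix (ι := Fin (m + 1)) (m := m + 1) (by simp)
    (fun i j => if j = finRotate (m + 1) i then (1 : MvPolynomial (Fin N) K) else 0) fun i j => by
      split_ifs
      exacts [isLeaf_one, isLeaf_zero]
  rwa [hamSum_of_single (isFullCycle_finRotate m) _ fun i j hij => if_neg hij,
    Finset.prod_eq_one fun i _ => if_pos rfl] at h

/-- The join has `m + n` vertices, and its entries are zeros and entries of the two matrices, hence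
still leaves. -/
theorem IsHCProjection.mul {m n : ℕ} {f g : MvPolynomial (Fin N) K} (hf : IsHCProjection m f)
    (hg : IsHCProjection n g) : IsHCProjection (m + n) (f * g) := by
  have := Fin.pos_iff_nonempty.1 hf.1
  obtain ⟨A, hA, rfl⟩ := hf.exists_matrix
  obtain ⟨B, hB, rfl⟩ := hg.exists_matrix
  rw [← hamSum_joinMatrix ⟨0, hf.1⟩ ⟨0, hg.1⟩]
  refine IsHCProjection.of_matrix (by simp) _ fun i j => ?_
  unfold joinMatrix
  generalize Equiv.swap _ _ j = k
  rcases i with i | i <;> rcases k with k | k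
  exacts [hA _ _, isLeaf_zero, isLeaf_zero, hB _ _]

/-- Both summands must live on the same vertex set, hence the common `m`; the factor 3 is the length
of the paths that replace vertices. -/
theorem IsHCProjection.add {m : ℕ} {f g : MvPolynomial (Fin N) K} (hf : IsHCProjection m f)
    (hg : IsHCProjection m g) : IsHCProjection (m * 3) (f + g) := by
  have := Fin.pos_iff_nonempty.1 hf.1
  obtain ⟨A, hA, rfl⟩ := hf.exists_matrix
  obtain ⟨B, hB, rfl⟩ := hg.exists_matrix
  rw [← hamSum_sumMatrix]
  refine IsHCProjection.of_matrix (by simp) _ ?_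
  have hite : ∀ v w : Fin m, IsLeaf (if w = v then (1 : MvPolynomial (Fin N) K) else 0) :=
    fun v w => by
      split_ifs
      exacts [isLeaf_one, isLeaf_zero]
  rintro ⟨v, i⟩ ⟨w, j⟩
  fin_cases i <;> fin_cases j
  exacts [isLeaf_zero, hite _ _, hB _ _, hite _ _, isLeaf_zero, hite _ _, hA _ _, hite _ _,
    isLeaf_zero]

/-- Multiplying by `1`, at the cost of one vertex, makes the size positive also for `n = 0`, where
`HC_0 = 1`. -/
theorem isHCProjection_aeval_hcPoly (n : ℕ) (v : Fin (n * n) → MvPolynomial (Fin N) K)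
    (hv : ∀ i, IsLeaf (v i)) : IsHCProjection (n + 1) (aeval v (hcPoly K n)) := by
  rcases Nat.eq_zero_or_pos n with rfl | hn
  · have : aeval v (hcPoly K 0) = 1 := by
      rw [aeval_hcPoly, hamSum_of_single (c := 1) (fun i => i.elim0) _ fun i => i.elim0]
      simp
    rw [this]
    exact isHCProjection_one one_pos
  · have h : IsHCProjection n (aeval v (hcPoly K n)) := ⟨hn, isProjection_iff.2 ⟨v, hv, rfl⟩⟩
    simpa using h.mul (isHCProjection_one one_pos)

theorem isHCProjection_one_add_mul (n : ℕ) (v : Fin (n * n) → MvPolynomial (Fin N) K)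
    (hv : ∀ i, IsLeaf (v i)) {p : MvPolynomial (Fin N) K} (hp : IsLeaf p) :
    IsHCProjection ((1 + (n + 1)) * 3) (1 + p * aeval v (hcPoly K n)) :=
  (isHCProjection_one (by omega)).add
    (hp.isHCProjection.mul (isHCProjection_aeval_hcPoly n v hv))

theorem isHCProjection_hcPoly_sq (n : ℕ) :
    IsHCProjection ((n + 1) + (n + 1)) (hcPoly K n ^ 2) := by
  have h := isHCProjection_aeval_hcPoly n (X : _ → MvPolynomial (Fin (n * n)) K) isLeaf_X
  rw [aeval_X_left, AlgHom.id_apply] at h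
  rw [sq]
  exact h.mul h

variable (K) in
/-- The polynomial `P_n`, as a polynomial in `n * n + 2` variables. -/
noncomputable def pPoly (n : ℕ) : MvPolynomial (Fin (n * n + 2)) K :=
  X (Fin.natAdd (n * n) 1) ^ 2 *
    (X (Fin.natAdd (n * n) 0) * rename (Fin.castAdd 2) (hcPoly K n) +
      X (Fin.natAdd (n * n) 0) ^ 2 * rename (Fin.castAdd 2) (hcPoly K n) ^ 2)

/-- The factorisation `P_n = z · z · y · H · (1 + yH)` is used; the summands of the size belong to
these factors in order. -/
theorem isHCProjection_pPoly (n : ℕ) :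
    IsHCProjection (1 + 1 + 1 + (n + 1) + (1 + (n + 1)) * 3) (pPoly K n) := by
  have hv : ∀ i : Fin (n * n), IsLeaf (X (Fin.castAdd 2 i) : MvPolynomial (Fin (n * n + 2)) K) :=
    fun i => isLeaf_X _
  have hz := isLeaf_X (K := K) (Fin.natAdd (n * n) (1 : Fin 2))
  have hy := isLeaf_X (K := K) (Fin.natAdd (n * n) (0 : Fin 2))
  have h := (((hz.isHCProjection.mul hz.isHCProjection).mul hy.isHCProjection).mul
    (isHCProjection_aeval_hcPoly n _ hv)).mul (isHCProjection_one_add_mul n _ hv hy)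
  have hr : rename (Fin.castAdd 2) (hcPoly K n) =
      aeval (fun i => (X (Fin.castAdd 2 i) : MvPolynomial (Fin (n * n + 2)) K)) (hcPoly K n) := by
    rw [← aeval_X_left_apply (rename (Fin.castAdd 2) (hcPoly K n)), aeval_rename]
    rfl
  rw [pPoly, hr]
  generalize aeval (fun i => (X (Fin.castAdd 2 i) : MvPolynomial (Fin (n * n + 2)) K))
    (hcPoly K n) = H at h ⊢
  have hring : ∀ y z : MvPolynomial (Fin (n * n + 2)) K,
      z ^ 2 * (y * H + y ^ 2 * H ^ 2) = z * z * y * H * (1 + y * H) := fun y z => by ring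
  exact (hring _ _).symm ▸ h

/-! ### Polynomial bounds -/

theorem eval_nat_mono (p : Polynomial ℕ) {a b : ℕ} (h : a ≤ b) : p.eval a ≤ p.eval b := by
  induction p using Polynomial.induction_on' with
  | add p q hp hq => rw [Polynomial.eval_add, Polynomial.eval_add]; exact add_le_add hp hq
  | monomial i c =>
    rw [Polynomial.eval_monomial, Polynomial.eval_monomial]
    exact Nat.mul_le_mul_left _ (Nat.pow_le_pow_left h i)

theorem PolyBounded.mono {s t : ℕ → ℕ} (ht : PolyBounded t) (h : ∀ n, s n ≤ t n) :
    PolyBounded s := by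
  obtain ⟨p, hp⟩ := ht
  exact ⟨p, fun n => (h n).trans (hp n)⟩

theorem PolyBounded.comp {s t : ℕ → ℕ} (hs : PolyBounded s) (ht : PolyBounded t) :
    PolyBounded fun n => s (t n) := by
  obtain ⟨p, hp⟩ := hs
  obtain ⟨q, hq⟩ := ht
  refine ⟨p.comp q, fun n => ?_⟩
  rw [Polynomial.eval_comp]
  exact (hp _).trans (eval_nat_mono p (hq n))

theorem polyBounded_id : PolyBounded fun n => n := ⟨Polynomial.X, fun n => by simp⟩

theorem polyBounded_const (c : ℕ) : PolyBounded fun _ => c :=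
  ⟨Polynomial.C c, fun n => by simp⟩

theorem PolyBounded.add {s t : ℕ → ℕ} (hs : PolyBounded s) (ht : PolyBounded t) :
    PolyBounded fun n => s n + t n := by
  obtain ⟨p, hp⟩ := hs
  obtain ⟨q, hq⟩ := ht
  exact ⟨p + q, fun n => by rw [Polynomial.eval_add]; exact add_le_add (hp n) (hq n)⟩

theorem PolyBounded.mul {s t : ℕ → ℕ} (hs : PolyBounded s) (ht : PolyBounded t) :
    PolyBounded fun n => s n * t n := by
  obtain ⟨p, hp⟩ := hs
  obtain ⟨q, hq⟩ := ht
  exact ⟨p * q, fun n => by rw [Polynomial.eval_mul]; exact Nat.mul_le_mul (hp n) (hq n)⟩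

/-! ### Membership in VNP -/

theorem totalDegree_hcPoly_le (n : ℕ) : (hcPoly K n).totalDegree ≤ n := by
  refine totalDegree_finsetSum_le fun π _ => ?_
  refine (totalDegree_finsetProd _ _).trans ?_
  simp

theorem HCsq_mem_VNP : HCsq K ∈ VNP K := by
  refine ⟨⟨polyBounded_id.mul polyBounded_id, ?_⟩, _, ?_, fun n => (isHCProjection_hcPoly_sq n).2⟩
  · refine ((polyBounded_const 2).mul polyBounded_id).mono fun n => ?_
    exact (totalDegree_pow _ _).trans (Nat.mul_le_mul_left _ (totalDegree_hcPoly_le n))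
  · have h := polyBounded_id.add (polyBounded_const 1)
    exact h.add h

theorem PFam_mem_VNP : PFam K ∈ VNP K := by
  have h1 := polyBounded_id.add (polyBounded_const 1)
  refine ⟨⟨(polyBounded_id.mul polyBounded_id).add (polyBounded_const 2), ?_⟩, _, ?_,
    fun n => (isHCProjection_pPoly n).2⟩
  · refine ((polyBounded_const 4).add ((polyBounded_const 2).mul polyBounded_id)).mono
      fun n => ?_
    have hh : (rename (Fin.castAdd 2) (hcPoly K n)).totalDegree ≤ n :=
      (totalDegree_rename_le _ _).trans (totalDegree_hcPoly_le n)
    have hpow : ∀ i : Fin (n * n + 2), (X i ^ 2 : MvPolynomial _ K).totalDegree ≤ 2 := fun i => by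
      simp
    have hX : ∀ i : Fin (n * n + 2), (X i : MvPolynomial _ K).totalDegree ≤ 1 := fun i => by
      simp
    have hh2 := (totalDegree_pow (rename (Fin.castAdd 2) (hcPoly K n)) 2).trans
      (Nat.mul_le_mul_left 2 hh)
    refine (totalDegree_mul _ _).trans ?_
    have hsum := (totalDegree_add (X (Fin.natAdd (n * n) 0) * rename (Fin.castAdd 2) (hcPoly K n))
      (X (Fin.natAdd (n * n) 0) ^ 2 * rename (Fin.castAdd 2) (hcPoly K n) ^ 2)).trans
      (max_le (c := 2 + 2 * n) ((totalDegree_mul _ _).trans ?_) ((totalDegree_mul _ _).trans ?_))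
    · exact (add_le_add (hpow _) hsum).trans (by omega)
    · exact (add_le_add (hX _) hh).trans (by omega)
    · exact add_le_add (hpow _) hh2
  · exact ((polyBounded_const _).add h1).add (((polyBounded_const 1).add h1).mul
      (polyBounded_const 3))

end Projections

/-! ### Circuits -/

section Circuits

variable {K : Type*} [Field K] {N M : ℕ}

/-- Some circuit with `s` nodes and `g`-oracle gates computes all polynomials in `S`. -/
def JointlyComputable (g : MvPolynomial (Fin M) K) (S : Set (MvPolynomial (Fin N) K)) (s : ℕ) :
    Prop :=
  ∃ c : Circuit K N M s, S ⊆ Set.range (c.values g)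

theorem jointlyComputable_empty (g : MvPolynomial (Fin M) K) :
    JointlyComputable g (∅ : Set (MvPolynomial (Fin N) K)) 0 :=
  ⟨.empty, Set.empty_subset _⟩

variable {g : MvPolynomial (Fin M) K} {S : Set (MvPolynomial (Fin N) K)} {s : ℕ}

theorem JointlyComputable.computableWithSize (h : JointlyComputable g S s)
    {f : MvPolynomial (Fin N) K} (hf : f ∈ S) : ComputableWithSize g f s := by
  obtain ⟨c, hc⟩ := h
  obtain ⟨j, hj⟩ := hc hf
  exact ⟨c, j, hj⟩

theorem JointlyComputable.oracleComplexity_le (h : JointlyComputable g S s)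
    {f : MvPolynomial (Fin N) K} (hf : f ∈ S) : oracleComplexity g f ≤ s :=
  Nat.sInf_le (h.computableWithSize hf)

theorem insert_subset_range_snoc {c : Circuit K N M s} (hc : S ⊆ Set.range (c.values g))
    (γ : Gate K N M s) :
    insert (γ.value g (c.values g)) S ⊆ Set.range ((c.snoc γ).values g) := by
  refine Set.insert_subset ⟨Fin.last _, by simp [Circuit.values]⟩ fun p hp => ?_
  obtain ⟨j, rfl⟩ := hc hp
  exact ⟨j.castSucc, by simp [Circuit.values]⟩

theorem JointlyComputable.insert_leaf (h : JointlyComputable g S s)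
    {p : MvPolynomial (Fin N) K} (hp : IsLeaf p) : JointlyComputable g (insert p S) (s + 1) := by
  obtain ⟨c, hc⟩ := h
  obtain ⟨j | a, rfl⟩ := hp
  · exact ⟨c.snoc (.var j), insert_subset_range_snoc hc (.var j)⟩
  · exact ⟨c.snoc (.const a), insert_subset_range_snoc hc (.const a)⟩

theorem JointlyComputable.insert_add (h : JointlyComputable g S s)
    {p q : MvPolynomial (Fin N) K} (hp : p ∈ S) (hq : q ∈ S) :
    JointlyComputable g (insert (p + q) S) (s + 1) := by
  obtain ⟨c, hc⟩ := h
  obtain ⟨i, rfl⟩ := hc hp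
  obtain ⟨j, rfl⟩ := hc hq
  exact ⟨c.snoc (.add i j), insert_subset_range_snoc hc (.add i j)⟩

theorem JointlyComputable.insert_mul (h : JointlyComputable g S s)
    {p q : MvPolynomial (Fin N) K} (hp : p ∈ S) (hq : q ∈ S) :
    JointlyComputable g (insert (p * q) S) (s + 1) := by
  obtain ⟨c, hc⟩ := h
  obtain ⟨i, rfl⟩ := hc hp
  obtain ⟨j, rfl⟩ := hc hq
  exact ⟨c.snoc (.mul i j), insert_subset_range_snoc hc (.mul i j)⟩

theorem JointlyComputable.insert_oracle (h : JointlyComputable g S s)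
    {v : Fin M → MvPolynomial (Fin N) K} (hv : ∀ i, v i ∈ S) :
    JointlyComputable g (insert (aeval v g) S) (s + 1) := by
  obtain ⟨c, hc⟩ := h
  choose a ha using fun i => hc (hv i)
  obtain rfl : (fun i => c.values g (a i)) = v := funext ha
  exact ⟨c.snoc (.oracle a), insert_subset_range_snoc hc (.oracle a)⟩

theorem JointlyComputable.mono {T : Set (MvPolynomial (Fin N) K)} (h : JointlyComputable g S s)
    (hT : T ⊆ S) : JointlyComputable g T s := by
  obtain ⟨c, hc⟩ := h
  exact ⟨c, hT.trans hc⟩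

theorem JointlyComputable.union_leaves (h : JointlyComputable g S s) {k : ℕ}
    (v : Fin k → MvPolynomial (Fin N) K) (hv : ∀ i, IsLeaf (v i)) :
    JointlyComputable g (Set.range v ∪ S) (s + k) := by
  induction k with
  | zero => exact h.mono (by simp)
  | succ k ih =>
    refine ((ih (fun i => v i.castSucc) fun i => hv _).insert_leaf (hv (Fin.last k))).mono ?_
    rintro p (⟨i, rfl⟩ | hp)
    · induction i using Fin.lastCases with
      | last => exact Or.inl rfl
      | cast i => exact Or.inr (Or.inl ⟨i, rfl⟩)
    · exact Or.inr (Or.inr hp)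

/-- Projections are computed with one oracle gate. -/
theorem JointlyComputable.insert_projection (h : JointlyComputable g S s)
    {f : MvPolynomial (Fin N) K} (hf : IsProjection f g) :
    JointlyComputable g (insert f S) (s + M + 1) := by
  obtain ⟨v, hv, rfl⟩ := isProjection_iff.1 hf
  exact ((h.union_leaves v hv).insert_oracle fun i => Or.inl ⟨i, rfl⟩).mono
    (Set.insert_subset_insert Set.subset_union_right)

theorem oracleComplexity_le_of_isProjection {f : MvPolynomial (Fin N) K}
    (hf : IsProjection f g) : oracleComplexity g f ≤ M + 1 := by
  simpa using ((jointlyComputable_empty g).insert_projection hf).oracleComplexity_le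
    (Set.mem_insert f ∅)

theorem aeval_map_map {L : Type*} [Field L] (φ : K →+* L) (g : MvPolynomial (Fin M) K)
    (v : Fin M → MvPolynomial (Fin N) K) :
    aeval (fun i => map φ (v i)) (map φ g) = map φ (aeval v g) := by
  induction g using MvPolynomial.induction_on with
  | C a => simp [← algebraMap_eq]
  | add p q hp hq => simp only [map_add, hp, hq]
  | mul_X p i hp => simp only [map_mul, hp, map_X, aeval_X]

/-- Circuits survive extension of scalars gate by gate; over `F(ε)` this turns an exact computation
into a border computation with `h = 0`. -/
theorem exists_circuit_map {L : Type*} [Field L] (φ : K →+* L) (g : MvPolynomial (Fin M) K)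
    {s : ℕ} (c : Circuit K N M s) :
    ∃ c' : Circuit L N M s, ∀ i, c'.values (map φ g) i = map φ (c.values g i) := by
  induction c with
  | empty => exact ⟨.empty, fun i => i.elim0⟩
  | @snoc s c γ ih =>
    obtain ⟨c', hc'⟩ := ih
    obtain ⟨γ', hγ'⟩ : ∃ γ' : Gate L N M s,
        γ'.value (map φ g) (c'.values (map φ g)) = map φ (γ.value g (c.values g)) := by
      cases γ with
      | var j => exact ⟨.var j, by simp [Gate.value]⟩
      | const a => exact ⟨.const (φ a), by simp [Gate.value]⟩
      | add i j => exact ⟨.add i j, by simp [Gate.value, hc']⟩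
      | mul i j => exact ⟨.mul i j, by simp [Gate.value, hc']⟩
      | oracle a =>
        refine ⟨.oracle a, ?_⟩
        simp only [Gate.value, hc']
        exact aeval_map_map φ g _
    refine ⟨c'.snoc γ', fun i => ?_⟩
    induction i using Fin.lastCases with
    | last => simpa [Circuit.values] using hγ'
    | cast i => simpa [Circuit.values] using hc' i

theorem ComputableWithSize.map {L : Type*} [Field L] (φ : K →+* L)
    {f : MvPolynomial (Fin N) K} (h : ComputableWithSize g f s) :
    ComputableWithSize (MvPolynomial.map φ g) (MvPolynomial.map φ f) s := by
  obtain ⟨c, j, hj⟩ := h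
  obtain ⟨c', hc'⟩ := exists_circuit_map φ g c
  exact ⟨c', j, by rw [hc', hj]⟩

theorem oracleComplexity_map_le {L : Type*} [Field L] (φ : K →+* L) (g : MvPolynomial (Fin M) K)
    (f : MvPolynomial (Fin N) K) :
    oracleComplexity (map φ g) (map φ f) ≤ oracleComplexity g f :=
  Nat.sInf_le (ComputableWithSize.map φ (Nat.sInf_mem (exists_computableWithSize g f)))

end Circuits

/-! ### Implications between the reductions -/

section Reductions

variable {F : Type*} [Field F]

theorem perturb_zero {N : ℕ} (f : MvPolynomial (Fin N) F) : perturb f 0 = extend f := by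
  simp [perturb]

theorem IsProjection.map {K L : Type*} [Field K] [Field L] {N M : ℕ} (φ : K →+* L)
    {f : MvPolynomial (Fin N) K} {g : MvPolynomial (Fin M) K} (h : IsProjection f g) :
    IsProjection (MvPolynomial.map φ f) (MvPolynomial.map φ g) := by
  obtain ⟨v, hv, rfl⟩ := isProjection_iff.1 h
  refine isProjection_iff.2 ⟨_, fun i => ?_, (aeval_map_map φ g v).symm⟩
  obtain ⟨j | a, ha⟩ := hv i
  · exact ⟨Sum.inl j, by simp [ha]⟩
  · exact ⟨Sum.inr (φ a), by simp [ha]⟩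

theorem IsProjection.isBorderProjection {N M : ℕ} {f : MvPolynomial (Fin N) F}
    {g : MvPolynomial (Fin M) F} (h : IsProjection f g) : IsBorderProjection f g :=
  ⟨0, by rw [perturb_zero]; exact h.map RatFunc.C⟩

theorem borderOracleComplexity_le {N M : ℕ} {f : MvPolynomial (Fin N) F}
    {g : MvPolynomial (Fin M) F} (h : MvPolynomial (Fin N) (Polynomial F)) :
    borderOracleComplexity g f ≤ oracleComplexity (extend g) (perturb f h) :=
  Nat.sInf_le ⟨h, le_rfl⟩

theorem PProj.borderPProj {f g : PolyFamily F} (h : PProj f g) : BorderPProj f g := by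
  obtain ⟨t, ht, h⟩ := h
  exact ⟨t, ht, fun n => (h n).isBorderProjection⟩

theorem CRed.borderCRed {f g : PolyFamily F} (h : CRed f g) : BorderCRed f g := by
  obtain ⟨t, ht, h⟩ := h
  refine ⟨t, ht, h.mono fun n => (borderOracleComplexity_le 0).trans ?_⟩
  rw [perturb_zero]
  exact oracleComplexity_map_le _ _ _

/-- That `g` is a p-family bounds the number of leaves feeding the single oracle gate. -/
theorem PProj.cRed {f g : PolyFamily F} (hg : IsPFamily g) (h : PProj f g) : CRed f g := by
  obtain ⟨t, ht, h⟩ := h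
  exact ⟨t, ht, ((hg.1.comp ht).add (polyBounded_const 1)).mono fun n =>
    oracleComplexity_le_of_isProjection (h n)⟩

theorem BorderPProj.borderCRed {f g : PolyFamily F} (hg : IsPFamily g) (h : BorderPProj f g) :
    BorderCRed f g := by
  obtain ⟨t, ht, h⟩ := h
  refine ⟨t, ht, ((hg.1.comp ht).add (polyBounded_const 1)).mono fun n => ?_⟩
  obtain ⟨p, hp⟩ := h n
  exact (borderOracleComplexity_le p).trans (oracleComplexity_le_of_isProjection hp)

end Reductions

/-! ### Squares of Hamiltonian cycle polynomials -/

section Squares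

variable {F : Type*} [Field F]

/-- Since `4H = (1 + H)² - (1 - H)²` and `1 ± H` are projections of `HC_m`, two projections of
`HC_m²` suffice. Each costs `m² + 1` nodes; the constants `±1/4`, two products and one sum add five.
-/
theorem oracleComplexity_hcPoly_le (h2 : (2 : F) ≠ 0) (n : ℕ) :
    oracleComplexity (hcPoly F ((1 + (n + 1)) * 3) ^ 2) (hcPoly F n) ≤
      2 * (((1 + (n + 1)) * 3) * ((1 + (n + 1)) * 3)) + 7 := by
  set m := (1 + (n + 1)) * 3
  set H := hcPoly F n with hH
  have hproj : ∀ c : F, IsProjection ((1 + C c * H) ^ 2) (hcPoly F m ^ 2) := by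
    intro c
    have h := (isHCProjection_one_add_mul n (X : _ → MvPolynomial (Fin (n * n)) F) isLeaf_X
      (isLeaf_C c)).2
    rw [aeval_X_left_apply] at h
    obtain ⟨α, hα⟩ := h
    exact ⟨α, by rw [hα, map_pow]⟩
  have h4 := ((jointlyComputable_empty (N := n * n) (hcPoly F m ^ 2)).insert_projection
    (hproj 1)).insert_projection (hproj (-1))
  have h5 := (h4.insert_leaf (isLeaf_C (4⁻¹ : F))).insert_leaf (isLeaf_C (-4⁻¹ : F))
  have h6 := (h5.insert_mul (p := C (4⁻¹ : F)) (q := (1 + C 1 * H) ^ 2) (by simp)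
    (by simp)).insert_mul (p := C (-4⁻¹ : F)) (q := (1 + C (-1) * H) ^ 2) (by simp) (by simp)
  have h7 := h6.insert_add (p := C (4⁻¹ : F) * (1 + C 1 * H) ^ 2)
    (q := C (-4⁻¹ : F) * (1 + C (-1) * H) ^ 2) (by simp) (by simp)
  have hfin : C (4⁻¹ : F) * (1 + C 1 * H) ^ 2 + C (-4⁻¹ : F) * (1 + C (-1) * H) ^ 2 = H := by
    have hC : (C (4⁻¹ : F) : MvPolynomial (Fin (n * n)) F) * 4 = 1 := by
      have h4' : (4 : F) ≠ 0 := by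
        have : (4 : F) = 2 * 2 := by norm_num
        rw [this]; exact mul_ne_zero h2 h2
      have : (4 : MvPolynomial (Fin (n * n)) F) = C 4 := (map_ofNat C 4).symm
      rw [this, ← C_mul, inv_mul_cancel₀ h4', C_1]
    simp only [C_neg, C_1]
    linear_combination H * hC
  refine (h7.oracleComplexity_le (f := H) (by rw [hfin]; simp)).trans ?_
  omega

theorem cRed_HC_HCsq (h2 : (2 : F) ≠ 0) : CRed (HC F) (HCsq F) := by
  have hm : PolyBounded fun n => (1 + (n + 1)) * 3 :=
    ((polyBounded_const 1).add (polyBounded_id.add (polyBounded_const 1))).mul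
      (polyBounded_const 3)
  exact ⟨_, hm, (((polyBounded_const 2).mul (hm.mul hm)).add (polyBounded_const 7)).mono
    fun n => oracleComplexity_hcPoly_le h2 n⟩

end Squares

/-! ### The border projection from `P` -/

section Border

variable {F : Type*} [Field F]

theorem isBorderProjection_hcPoly_pPoly (n : ℕ) :
    IsBorderProjection (hcPoly F n) (pPoly F n) := by
  let ε : RatFunc F := RatFunc.X
  have hε : ε ≠ 0 := RatFunc.X_ne_zero
  -- With `y = ε²` and `z = ε⁻¹`, `P_n` becomes `H + ε²H² = H + ε(εH²)`, so `h = εH²`.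
  refine ⟨C Polynomial.X * map Polynomial.C (hcPoly F n) ^ 2, isProjection_iff.2
    ⟨Fin.addCases (fun i => X i) ![C ε ^ 2, C ε⁻¹], fun i => ?_, ?_⟩⟩
  · refine Fin.addCases (fun i => ?_) (fun i => ?_) i
    · simpa using isLeaf_X i
    · fin_cases i
      · simp only [Fin.addCases_right]
        exact C_pow (σ := Fin (n * n)) ε 2 ▸ isLeaf_C (ε ^ 2)
      · simp only [Fin.addCases_right]
        exact isLeaf_C ε⁻¹
  · have hC : (algebraMap (Polynomial F) (RatFunc F)).comp Polynomial.C = RatFunc.C := by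
      ext a; simp
    have hext : extend (rename (Fin.castAdd 2) (hcPoly F n)) =
        rename (Fin.castAdd 2) (extend (hcPoly F n)) := map_rename _ _ _
    have hH : aeval (Fin.addCases (fun i => X i) ![C ε ^ 2, C ε⁻¹] :
          Fin (n * n + 2) → MvPolynomial (Fin (n * n)) (RatFunc F))
        (rename (Fin.castAdd 2) (extend (hcPoly F n))) = extend (hcPoly F n) := by
      rw [aeval_rename]
      have : ((Fin.addCases (fun i => X i) ![C ε ^ 2, C ε⁻¹] :
          Fin (n * n + 2) → MvPolynomial (Fin (n * n)) (RatFunc F)) ∘ Fin.castAdd 2) = X := by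
        ext1 i; simp
      rw [this, aeval_X_left_apply]
    have hP : extend (pPoly F n) = X (Fin.natAdd (n * n) 1) ^ 2 *
      (X (Fin.natAdd (n * n) 0) * rename (Fin.castAdd 2) (extend (hcPoly F n)) +
        X (Fin.natAdd (n * n) 0) ^ 2 * rename (Fin.castAdd 2) (extend (hcPoly F n)) ^ 2) := by
      rw [← hext, pPoly]
      simp only [extend, map_mul, map_add, map_pow, map_X]
    have hpert : perturb (hcPoly F n) (C Polynomial.X * map Polynomial.C (hcPoly F n) ^ 2) =
        extend (hcPoly F n) + C ε ^ 2 * extend (hcPoly F n) ^ 2 := by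
      simp only [perturb, map_mul, map_pow, map_map, hC, map_C, RatFunc.algebraMap_X, extend]
      ring
    refine hpert.trans (Eq.trans ?_ (congrArg _ hP).symm)
    have hcancel : (C ε⁻¹ : MvPolynomial (Fin (n * n)) (RatFunc F)) * C ε = 1 := by
      rw [← C_mul, inv_mul_cancel₀ hε, C_1]
    simp only [map_mul, map_add, map_pow, hH, aeval_X, Fin.addCases_right]
    simp only [Matrix.cons_val_zero, Matrix.cons_val_one]
    generalize extend (hcPoly F n) = H
    linear_combination (-(1 + C ε⁻¹ * C ε) * (H + C ε ^ 2 * H ^ 2)) * hcancel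

theorem borderPProj_HC_PFam : BorderPProj (HC F) (PFam F) :=
  ⟨_, polyBounded_id, isBorderProjection_hcPoly_pPoly⟩

end Border

/-! ### Impossible reductions -/

section Impossibility

variable {F : Type*} [Field F]

open Classical in
/-- The substitution which sends `x_{i,j}` to `0`, except for the variables on the cycle
`finRotate`: these are sent to `1`, one of them to the indeterminate. -/
noncomputable def cycleSubst (R : Type*) [CommRing R] (n : ℕ) (k : Fin ((n + 1) * (n + 1))) :
    Polynomial R :=
  if (finProdFinEquiv.symm k).2 = finRotate (n + 1) (finProdFinEquiv.symm k).1 then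
    (if (finProdFinEquiv.symm k).1 = 0 then Polynomial.X else 1) else 0

theorem aeval_cycleSubst_hcPoly (n : ℕ) :
    aeval (cycleSubst F n) (hcPoly F (n + 1)) = Polynomial.X := by
  rw [aeval_hcPoly, hamSum_of_single (isFullCycle_finRotate n)]
  · simp only [cycleSubst, Equiv.symm_apply_apply, if_true]
    rw [Finset.prod_ite_eq']
    simp
  · intro i j hij
    simp only [cycleSubst, Equiv.symm_apply_apply]
    exact if_neg hij

/-- The specialisation has coefficients `0` and `1`, so it is compatible with the passage from `F`
and from `F[ε]` to `F(ε)`. -/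
theorem aeval_cycleSubst_map {R S : Type*} [CommRing R] [CommRing S] (φ : R →+* S) (n : ℕ)
    (p : MvPolynomial (Fin ((n + 1) * (n + 1))) R) :
    aeval (cycleSubst S n) (map φ p) = (aeval (cycleSubst R n) p).map φ := by
  induction p using MvPolynomial.induction_on with
  | C a => simp [Polynomial.algebraMap_eq]
  | add p q hp hq => simp [hp, hq]
  | mul_X p i hp =>
    simp only [map_mul, hp, map_X, aeval_X, Polynomial.map_mul]
    congr 1
    simp only [cycleSubst]
    split_ifs <;> simp

/-- `X + ε h` is not a square over `F(ε)`. -/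
theorem X_add_ne_sq (h : Polynomial (Polynomial F)) (q : Polynomial (RatFunc F)) :
    (Polynomial.X + Polynomial.C Polynomial.X * h).map (algebraMap (Polynomial F) (RatFunc F)) ≠
      q ^ 2 := by
  intro hq
  -- Denominators are cleared: `r = d q` has coefficients in `F[ε]`.
  obtain ⟨d, hd0, hd⟩ := IsLocalization.integerNormalization_spec
    (nonZeroDivisors (Polynomial F)) q
  set r := IsLocalization.integerNormalization (nonZeroDivisors (Polynomial F)) q
  have hinj : Function.Injective (Polynomial.map (algebraMap (Polynomial F) (RatFunc F))) :=
    Polynomial.map_injective _ (IsFractionRing.injective _ _)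
  have hsq : Polynomial.C d ^ 2 * (Polynomial.X + Polynomial.C Polynomial.X * h)
      = r ^ 2 := by
    apply hinj
    rw [Polynomial.map_mul, hq, Polynomial.map_pow, Polynomial.map_pow, hd, Polynomial.map_C,
      ← mul_pow]
    congr 1
    rw [Algebra.smul_def]
    rfl
  have hC0 : (Polynomial.C d) ≠ 0 := by
    rw [Ne, Polynomial.C_eq_zero]
    exact nonZeroDivisors.ne_zero hd0
  -- In the factorial ring `F[ε][X]`, `d² ∣ r²` forces `d ∣ r`, so `X + εh` is a square already over
  -- `F[ε]`, where `ε = 0` may be substituted.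
  obtain ⟨s, hs⟩ : Polynomial.C d ∣ r :=
    (UniqueFactorizationMonoid.pow_dvd_pow_iff_dvd two_ne_zero).1 ⟨_, hsq.symm⟩
  rw [hs, mul_pow] at hsq
  have hX := mul_left_cancel₀ (pow_ne_zero 2 hC0) hsq
  have hX0 : (Polynomial.X : Polynomial F) =
      (s.map (Polynomial.evalRingHom 0)) ^ 2 := by
    rw [← Polynomial.map_pow, ← hX]
    simp
  have := congrArg Polynomial.natDegree hX0
  rw [Polynomial.natDegree_X, Polynomial.natDegree_pow] at this
  omega

/-- Substitution maps squares to squares, so only the shape `g ^ 2` of the oracle matters, not its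
size. -/
theorem not_isBorderProjection_hcPoly_sq (n : ℕ) {M : ℕ} (g : MvPolynomial (Fin M) F) :
    ¬ IsBorderProjection (hcPoly F (n + 1)) (g ^ 2) := by
  rintro ⟨h, α, hα⟩
  refine X_add_ne_sq (aeval (cycleSubst (Polynomial F) n) h) (aeval (cycleSubst (RatFunc F) n)
    (aeval (fun i => Sum.elim X C (α i)) (extend g))) ?_
  rw [← map_pow, ← map_pow, extend, ← map_pow, ← extend, ← hα, perturb, extend, map_add,
    map_mul, aeval_cycleSubst_map, aeval_cycleSubst_map, aeval_cycleSubst_hcPoly]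
  simp [Polynomial.algebraMap_eq]

/-- As `1 + u` has the degree of `u`, a nonzero right side has degree `2 deg a + 2 deg u`, which is
even. -/
theorem X_ne_sq_mul (a u : Polynomial F) : (Polynomial.X : Polynomial F) ≠ a ^ 2 * (u + u ^ 2) := by
  intro h
  have hne : a ^ 2 * (u * (1 + u)) ≠ 0 := by
    rw [show u * (1 + u) = u + u ^ 2 by ring, ← h]; exact Polynomial.X_ne_zero
  have ha := left_ne_zero_of_mul hne
  have hu := left_ne_zero_of_mul (right_ne_zero_of_mul hne)
  have hu1 := right_ne_zero_of_mul (right_ne_zero_of_mul hne)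
  have hdeg := congrArg Polynomial.natDegree h
  rw [show u + u ^ 2 = u * (1 + u) by ring, Polynomial.natDegree_X, Polynomial.natDegree_mul ha
    (mul_ne_zero hu hu1), Polynomial.natDegree_pow, Polynomial.natDegree_mul hu hu1,
    ← Polynomial.C_1, add_comm (Polynomial.C (1 : F)), Polynomial.natDegree_add_C] at hdeg
  omega

theorem not_isProjection_hcPoly_pPoly (n m : ℕ) :
    ¬ IsProjection (hcPoly F (n + 1)) (pPoly F m) := by
  rintro ⟨α, hα⟩
  rw [pPoly] at hα
  have h := congrArg (aeval (cycleSubst F n)) hα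
  rw [aeval_cycleSubst_hcPoly] at h
  -- Here `a` is the image of `z` and `u` the image of `y HC_m`.
  simp only [map_mul, map_add, map_pow, ← mul_pow] at h
  exact X_ne_sq_mul _ _ h

theorem not_borderPProj_HC_HCsq : ¬ BorderPProj (HC F) (HCsq F) := by
  rintro ⟨t, -, h⟩
  -- `HC_0 = 1` is a square; the obstruction starts with `HC_1`, a single variable.
  exact not_isBorderProjection_hcPoly_sq 0 _ (h 1)

theorem not_pProj_HC_PFam : ¬ PProj (HC F) (PFam F) := by
  rintro ⟨t, -, h⟩
  exact not_isProjection_hcPoly_pPoly 0 _ (h 1)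

end Impossibility

end AlgRed

open AlgRed
theorem theorem2 (F : Type) [Field F]
    (hF : Nonempty (F ≃+* ℚ) ∨ Nonempty (F ≃+* ℝ) ∨ Nonempty (F ≃+* ℂ)) :
    -- the inclusions (solid arrows)
    (VNPC (F := F) PProj ⊆ VNPC CRed ∧
      VNPC (F := F) PProj ⊆ VNPC BorderPProj ∧
      VNPC (F := F) CRed ⊆ VNPC BorderCRed ∧
      VNPC (F := F) BorderPProj ⊆ VNPC BorderCRed) ∧
    -- the non-inclusions (dashed arrows)
    (¬ VNPC (F := F) CRed ⊆ VNPC PProj ∧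
      ¬ VNPC (F := F) BorderPProj ⊆ VNPC PProj ∧
      ¬ VNPC (F := F) CRed ⊆ VNPC BorderPProj ∧
      ¬ VNPC (F := F) BorderCRed ⊆ VNPC BorderPProj) ∧
    -- the separating families
    (HCsq F ∈ VNPC CRed ∧ HCsq F ∉ VNPC BorderPProj) ∧
    (PFam F ∈ VNPC BorderPProj ∧ PFam F ∉ VNPC PProj) := by
  -- The choice of field enters only here, to allow division by 4.
  have h2 : (2 : F) ≠ 0 := by
    intro h
    rcases hF with ⟨⟨e⟩⟩ | ⟨⟨e⟩⟩ | ⟨⟨e⟩⟩ <;>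
    · have := congrArg e h
      rw [map_ofNat, map_zero] at this
      norm_num at this
  have hsq : HCsq F ∈ VNPC CRed := ⟨HCsq_mem_VNP, cRed_HC_HCsq h2⟩
  have hsq' : HCsq F ∉ VNPC BorderPProj := fun h => not_borderPProj_HC_HCsq h.2
  have hP : PFam F ∈ VNPC BorderPProj := ⟨PFam_mem_VNP, borderPProj_HC_PFam⟩
  have hP' : PFam F ∉ VNPC PProj := fun h => not_pProj_HC_PFam h.2
  have hCB : VNPC (F := F) CRed ⊆ VNPC BorderCRed := fun _ h => ⟨h.1, h.2.borderCRed⟩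
  have hPB : VNPC (F := F) PProj ⊆ VNPC BorderPProj := fun _ h => ⟨h.1, h.2.borderPProj⟩
  exact ⟨⟨fun _ h => ⟨h.1, h.2.cRed h.1.1⟩, hPB, hCB, fun _ h => ⟨h.1, h.2.borderCRed h.1.1⟩⟩,
    ⟨fun h => hsq' (hPB (h hsq)), fun h => hP' (h hP), fun h => hsq' (h hsq),
      fun h => hsq' (h (hCB hsq))⟩, ⟨hsq, hsq'⟩, hP, hP'⟩
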